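/- Let $R$ be a (unital, associative) ring that is right hereditary, i.e. every right ideal of $R$ is a projective right $R$-module, and let $M$ be a right $R$-module. The following are equivalent: 1. $\operatorname{Ext}^1_R(M,-)$ commutes with direct limits: for every direct system $(M_i,\upsilon_{ij})_{i,j\in I}$ of right $R$-modules over a directed set $I$, the canonical homomorphism $\varinjlim \operatorname{Ext}^1_R(M,M_i)\to \operatorname{Ext}^1_R(M,\varinjlim M_i)$, induced by the canonical maps $M_i\to\varinjlim M_i$, is an isomorphism; 2. $\operatorname{Ext}^1_R(M,-)$ commutes with direct sums: for every family $(M_i)_{i\in I}$ of right $R$-modules, the canonical homomorphism $\bigoplus_{i\in I}\operatorname{Ext}^1_R(M,M_i)\to \operatorname{Ext}^1_R(M,\bigoplus_{i\in I}M_i)$, induced by the inclusions $M_i\to\bigoplus_{i\in I} M_i$, is an isomorphism; 3. $\operatorname{Ext}^1_R(M,-)$ commutes with direct sums of copies of $R$: for every set $I$, the canonical homomorphism $\operatorname{Ext}^1_R(M,R)^{(I)}\to \operatorname{Ext}^1_R(M,R^{(I)})$ is an isomorphism; 4. $M=N\oplus P$ for some submodules $N,P\subseteq M$ with $N$ finitely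 presented and $P$ projective. -/

import Mathlib

open CategoryTheory

universe u

/-- A ring `R` is right hereditary if every right ideal of `R`, that is, every submodule of `R`
regarded as a right module over itself, is projective. Right `R`-modules are modules over
`Rᵐᵒᵖ`. -/
def IsRightHereditary (R : Type u) [Ring R] : Prop :=
  ∀ I : Submodule Rᵐᵒᵖ R, Module.Projective Rᵐᵒᵖ I

namespace ExtComm

variable {S : Type u} [Ring S]

/-- The homomorphism `Extⁿ(M, A) → Extⁿ(M, B)` induced by a linear map `g : A → B`. -/
noncomputable def extMap (n : ℕ) (M : Type u) [AddCommGroup M] [Module S M]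
    {A B : Type u} [AddCommGroup A] [Module S A] [AddCommGroup B] [Module S B]
    (g : A →ₗ[S] B) :
    Abelian.Ext.{u} (ModuleCat.of S M) (ModuleCat.of S A) n →+
      Abelian.Ext.{u} (ModuleCat.of S M) (ModuleCat.of S B) n :=
  (Abelian.Ext.mk₀ (ModuleCat.ofHom g)).postcomp (ModuleCat.of S M) (add_zero n)

theorem extMap_extMap (n : ℕ) (M : Type u) [AddCommGroup M] [Module S M]
    {A B C : Type u} [AddCommGroup A] [Module S A] [AddCommGroup B] [Module S B]
    [AddCommGroup C] [Module S C] (g : A →ₗ[S] B) (h : B →ₗ[S] C)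
    (x : Abelian.Ext.{u} (ModuleCat.of S M) (ModuleCat.of S A) n) :
    extMap n M h (extMap n M g x) = extMap n M (h ∘ₗ g) x := by
  simp [extMap, ModuleCat.ofHom_comp]

/-- The canonical homomorphism `⨁ Extⁿ(M, Aᵢ) → Extⁿ(M, ⨁ Aᵢ)`, induced by the inclusions
`Aᵢ → ⨁ Aᵢ`. -/
noncomputable def directSumMap (n : ℕ) (M : Type u) [AddCommGroup M] [Module S M]
    {ι : Type u} [DecidableEq ι] (A : ι → Type u)
    [∀ i, AddCommGroup (A i)] [∀ i, Module S (A i)] :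
    (DirectSum ι fun i => Abelian.Ext.{u} (ModuleCat.of S M) (ModuleCat.of S (A i)) n) →+
      Abelian.Ext.{u} (ModuleCat.of S M) (ModuleCat.of S (DirectSum ι A)) n :=
  DirectSum.toAddMonoid fun i => extMap n M (DirectSum.lof S ι A i)

/-- The canonical homomorphism `lim Extⁿ(M, Aᵢ) → Extⁿ(M, lim Aᵢ)` for a direct system
`(Aᵢ, fᵢⱼ)`, induced by the canonical maps `Aᵢ → lim Aᵢ`. -/
noncomputable def directLimitMap (n : ℕ) (M : Type u) [AddCommGroup M] [Module S M]
    {ι : Type u} [DecidableEq ι] [Preorder ι] (A : ι → Type u)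
    [∀ i, AddCommGroup (A i)] [∀ i, Module S (A i)] (f : ∀ i j, i ≤ j → A i →ₗ[S] A j) :
    AddCommGroup.DirectLimit
        (fun i => Abelian.Ext.{u} (ModuleCat.of S M) (ModuleCat.of S (A i)) n)
        (fun i j hij => extMap n M (f i j hij)) →+
      Abelian.Ext.{u} (ModuleCat.of S M) (ModuleCat.of S (Module.DirectLimit A f)) n :=
  AddCommGroup.DirectLimit.lift _ _ _
    (fun i => extMap n M (Module.DirectLimit.of S ι A f i))
    (fun i j hij x => by
      rw [extMap_extMap]
      congr 2
      ext a
      exact Module.DirectLimit.of_f)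

variable (S)

/-- `Extⁿ(M, -)` commutes with direct limits: the canonical homomorphism
`lim Extⁿ(M, Aᵢ) → Extⁿ(M, lim Aᵢ)` is an isomorphism for every direct system over a directed
set. -/
def CommutesWithDirectLimits (n : ℕ) (M : Type u) [AddCommGroup M] [Module S M] : Prop :=
  ∀ (ι : Type u) [DecidableEq ι] [Preorder ι] [Nonempty ι] [IsDirectedOrder ι] (A : ι → Type u)
    [∀ i, AddCommGroup (A i)] [∀ i, Module S (A i)] (f : ∀ i j, i ≤ j → A i →ₗ[S] A j)
    [DirectedSystem A (fun i j hij => f i j hij)],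
    Function.Bijective (directLimitMap n M A f)

/-- `Extⁿ(M, -)` commutes with direct sums: the canonical homomorphism
`⨁ Extⁿ(M, Aᵢ) → Extⁿ(M, ⨁ Aᵢ)` is an isomorphism for every family of modules. -/
def CommutesWithDirectSums (n : ℕ) (M : Type u) [AddCommGroup M] [Module S M] : Prop :=
  ∀ (ι : Type u) [DecidableEq ι] (A : ι → Type u)
    [∀ i, AddCommGroup (A i)] [∀ i, Module S (A i)],
    Function.Bijective (directSumMap (S := S) n M A)

/-- `Extⁿ(M, -)` commutes with direct sums of copies of the module `B`. -/
def CommutesWithDirectSumsOfCopies (n : ℕ) (M B : Type u) [AddCommGroup M] [Module S M]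
    [AddCommGroup B] [Module S B] : Prop :=
  ∀ (ι : Type u) [DecidableEq ι],
    Function.Bijective (directSumMap (S := S) n M (fun _ : ι => B))

end ExtComm

/-! For a surjection `p : F → M` with `F` projective, `Ext¹(M, A)` is `Hom(ker p, A)` modulo the
maps that extend to `F`, naturally in `A`; `connecting` is the quotient map. So everything reduces
to maps out of `ker p`.

If `M = N ⊕ P`, such a `p` exists with `ker p` finitely generated, hence projective by heredity.
Maps out of `ker p` then pass through finite subsums and through stages of a direct limit
(`commutes_of_isCompl`).

Conversely, let `F` be free and consider the class of the identity of `ker p`. Conditions 1 and 3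
each make it equal to the class of some `k` with image in a finitely generated `L`. Then `id - k`
extends to `g : F → ker p`, and `id - g` maps `ker p` into `L`, which involves only finitely many
coordinates of `F`. The remaining coordinates give a map from `M` to a free module. By heredity its
image is projective, so it splits off; its kernel is a retract of a finitely presented module
(`exists_isCompl_of_fg`). -/

namespace ExtComm

/-! ### `Ext¹` through the connecting homomorphism. -/

section Connecting

variable {S : Type u} [Ring S] {M F : Type u} [AddCommGroup M] [Module S M] [AddCommGroup F]
  [Module S F]

/-- The short complex `ker p → F → M` of a linear map `p : F → M`. -/
noncomputable def kerShortComplex (p : F →ₗ[S] M) : ShortComplex (ModuleCat.{u} S) :=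
  ShortComplex.moduleCatMk (LinearMap.ker p).subtype p (by ext x; simp)

theorem kerShortComplex_shortExact {p : F →ₗ[S] M} (hp : Function.Surjective p) :
    (kerShortComplex p).ShortExact where
  exact := by
    rw [ShortComplex.moduleCat_exact_iff]
    intro x hx
    exact ⟨⟨x, hx⟩, rfl⟩
  mono_f := (ModuleCat.mono_iff_injective _).2 Subtype.val_injective
  epi_g := (ModuleCat.epi_iff_surjective _).2 hp

/-- The class in `Ext¹(M, ker p)` of the extension given by a surjection `p : F → M`. -/
noncomputable def kerExtClass {p : F →ₗ[S] M} (hp : Function.Surjective p) :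
    Abelian.Ext.{u} (ModuleCat.of S M) (ModuleCat.of S (LinearMap.ker p)) 1 :=
  (kerShortComplex_shortExact hp).extClass

/-- The connecting homomorphism `Hom(ker p, A) → Ext¹(M, A)` of a surjection `p : F → M`. -/
noncomputable def connecting {p : F →ₗ[S] M} (hp : Function.Surjective p)
    {A : Type u} [AddCommGroup A] [Module S A] (h : LinearMap.ker p →ₗ[S] A) :
    Abelian.Ext.{u} (ModuleCat.of S M) (ModuleCat.of S A) 1 :=
  (kerExtClass hp).comp (Abelian.Ext.mk₀ (ModuleCat.ofHom h)) (add_zero 1)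

variable {p : F →ₗ[S] M} (hp : Function.Surjective p)
  {A B : Type u} [AddCommGroup A] [Module S A] [AddCommGroup B] [Module S B]

theorem connecting_add (h k : LinearMap.ker p →ₗ[S] A) :
    connecting hp (h + k) = connecting hp h + connecting hp k := by
  simp [connecting, ModuleCat.ofHom_add, Abelian.Ext.mk₀_add]

theorem connecting_sum {ι : Type*} (s : Finset ι) (h : ι → LinearMap.ker p →ₗ[S] A) :
    connecting hp (∑ i ∈ s, h i) = ∑ i ∈ s, connecting hp (h i) :=
  map_sum (AddMonoidHom.mk' (connecting hp (A := A)) (connecting_add hp)) h s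

theorem connecting_sub (h k : LinearMap.ker p →ₗ[S] A) :
    connecting hp (h - k) = connecting hp h - connecting hp k :=
  map_sub (AddMonoidHom.mk' (connecting hp (A := A)) (connecting_add hp)) h k

theorem extMap_connecting (g : A →ₗ[S] B) (h : LinearMap.ker p →ₗ[S] A) :
    extMap 1 M g (connecting hp h) = connecting hp (g ∘ₗ h) := by
  simp [extMap, connecting, ModuleCat.ofHom_comp]

theorem connecting_eq_zero_of_extends (w : F →ₗ[S] A) :
    connecting hp (w ∘ₗ (LinearMap.ker p).subtype) = 0 := by
  have h : (kerExtClass hp).comp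
      (Abelian.Ext.mk₀ (ModuleCat.ofHom (LinearMap.ker p).subtype)) (add_zero 1) = 0 :=
    (kerShortComplex_shortExact hp).extClass_comp
  have := extMap_connecting hp w (LinearMap.ker p).subtype
  rw [← this, connecting, h, map_zero]

theorem exists_extends_of_connecting_eq_zero {h : LinearMap.ker p →ₗ[S] A}
    (hh : connecting hp h = 0) : ∃ w : F →ₗ[S] A, w ∘ₗ (LinearMap.ker p).subtype = h := by
  obtain ⟨w, hw⟩ := Abelian.Ext.contravariant_sequence_exact₁ (kerShortComplex_shortExact hp)
    _ _ (add_zero 1) hh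
  obtain ⟨w, rfl⟩ := Abelian.Ext.mk₀_bijective _ _ |>.2 w
  rw [Abelian.Ext.mk₀_comp_mk₀] at hw
  exact ⟨w.hom, congrArg ModuleCat.Hom.hom ((Abelian.Ext.mk₀_bijective _ _).1 hw)⟩

theorem connecting_surjective [Module.Projective S F] :
    Function.Surjective (connecting hp (A := A)) := by
  intro x
  have : Projective (kerShortComplex p).X₂ :=
    (IsProjective.iff_projective (ModuleCat.of S F)).1 ‹_›
  obtain ⟨h, hh⟩ := Abelian.Ext.contravariant_sequence_exact₃ (kerShortComplex_shortExact hp)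
    _ x (Abelian.Ext.eq_zero_of_projective _) (add_zero 1)
  obtain ⟨h, rfl⟩ := Abelian.Ext.mk₀_bijective _ _ |>.2 h
  exact ⟨h.hom, hh⟩

end Connecting

/-! ### `Ext` and direct sums. -/

section DirectSum

variable {S : Type u} [Ring S] (M : Type u) [AddCommGroup M] [Module S M]
  {ι : Type u} [DecidableEq ι] (A : ι → Type u) [∀ i, AddCommGroup (A i)] [∀ i, Module S (A i)]

theorem extMap_id (n : ℕ) (B : Type u) [AddCommGroup B] [Module S B]
    (x : Abelian.Ext.{u} (ModuleCat.of S M) (ModuleCat.of S B) n) :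
    extMap n M (LinearMap.id : B →ₗ[S] B) x = x := by
  simp [extMap]

theorem extMap_zero (n : ℕ) (B C : Type u) [AddCommGroup B] [Module S B] [AddCommGroup C]
    [Module S C] (x : Abelian.Ext.{u} (ModuleCat.of S M) (ModuleCat.of S B) n) :
    extMap n M (0 : B →ₗ[S] C) x = 0 := by
  simp [extMap]

theorem directSumMap_of (n : ℕ) (i : ι)
    (x : Abelian.Ext.{u} (ModuleCat.of S M) (ModuleCat.of S (A i)) n) :
    directSumMap (S := S) n M A (DirectSum.of _ i x) = extMap n M (DirectSum.lof S ι A i) x :=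
  DirectSum.toAddMonoid_of _ _ _

theorem extMap_component_directSumMap (n : ℕ) (i : ι)
    (x : DirectSum ι fun i => Abelian.Ext.{u} (ModuleCat.of S M) (ModuleCat.of S (A i)) n) :
    extMap n M (DirectSum.component S ι A i) (directSumMap (S := S) n M A x) = x i := by
  induction x using DirectSum.induction_on with
  | zero => simp
  | add x y hx hy => simp [hx, hy]
  | of j x =>
    rw [directSumMap_of, extMap_extMap]
    by_cases hij : j = i
    · subst hij
      have : DirectSum.component S ι A j ∘ₗ DirectSum.lof S ι A j = LinearMap.id := by
        ext a; simp
      rw [this, extMap_id, DirectSum.of_eq_same]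
    · have : DirectSum.component S ι A i ∘ₗ DirectSum.lof S ι A j = 0 := by
        ext a
        simp [DirectSum.component.of, hij]
      rw [this, extMap_zero, DirectSum.of_eq_of_ne _ _ _ (Ne.symm hij)]

/-- The projections recover each component, so only surjectivity can fail. -/
theorem directSumMap_injective (n : ℕ) : Function.Injective (directSumMap (S := S) n M A) := by
  intro x y hxy
  refine DFinsupp.ext fun i => ?_
  rw [← extMap_component_directSumMap, hxy, extMap_component_directSumMap]

variable {M A} in
-- The images of finitely many generators meet only finitely many summands.
theorem exists_sum_lof_comp_component {K : Type*} [AddCommGroup K] [Module S K]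
    [Module.Finite S K] (h : K →ₗ[S] DirectSum ι A) :
    ∃ s : Finset ι, h = ∑ i ∈ s,
      DirectSum.lof S ι A i ∘ₗ DirectSum.component S ι A i ∘ₗ h := by
  classical
  obtain ⟨t, ht⟩ := Module.Finite.fg_top (R := S) (M := K)
  refine ⟨t.biUnion fun k => (h k).support, LinearMap.ext_on ht fun k hk => ?_⟩
  refine DFinsupp.ext fun j => ?_
  simp only [LinearMap.sum_apply, LinearMap.comp_apply, DirectSum.lof_eq_of, DirectSum.sum_apply]
  change h k j = ∑ i ∈ t.biUnion fun k => (h k).support, DirectSum.of A i (h k i) j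
  by_cases hj : h k j = 0
  · rw [hj, eq_comm]
    refine Finset.sum_eq_zero fun i _ => ?_
    by_cases hij : i = j
    · subst hij; simpa using hj
    · exact DirectSum.of_eq_of_ne _ _ _ (Ne.symm hij)
  · rw [Finset.sum_eq_single j]
    · simp
    · exact fun i _ hij => DirectSum.of_eq_of_ne _ _ _ (Ne.symm hij)
    · intro hj'
      exact absurd (Finset.mem_biUnion.2 ⟨k, hk, DFinsupp.mem_support_iff.2 hj⟩) hj'

variable {M} in
theorem directSumMap_surjective {F : Type u} [AddCommGroup F] [Module S F]
    [Module.Projective S F] {p : F →ₗ[S] M} (hp : Function.Surjective p)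
    [Module.Finite S (LinearMap.ker p)] : Function.Surjective (directSumMap (S := S) 1 M A) := by
  intro x
  obtain ⟨h, rfl⟩ := connecting_surjective hp x
  obtain ⟨s, hs⟩ := exists_sum_lof_comp_component h
  refine ⟨∑ i ∈ s, DirectSum.of _ i (connecting hp (DirectSum.component S ι A i ∘ₗ h)), ?_⟩
  conv_rhs => rw [hs]
  rw [connecting_sum, map_sum]
  refine Finset.sum_congr rfl fun i _ => ?_
  rw [directSumMap_of, extMap_connecting]

end DirectSum

/-! ### `Ext¹` and direct limits. -/

section DirectLimit

variable {S : Type u} [Ring S] (M : Type u) [AddCommGroup M] [Module S M]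
  {ι : Type u} [DecidableEq ι] [Preorder ι] {A : ι → Type u}
  [∀ i, AddCommGroup (A i)] [∀ i, Module S (A i)] (f : ∀ i j, i ≤ j → A i →ₗ[S] A j)

theorem directLimitMap_of (n : ℕ) (i : ι)
    (x : Abelian.Ext.{u} (ModuleCat.of S M) (ModuleCat.of S (A i)) n) :
    directLimitMap n M A f (AddCommGroup.DirectLimit.of _ _ i x) =
      extMap n M (Module.DirectLimit.of S ι A f i) x :=
  AddCommGroup.DirectLimit.lift_of _ _ _ _ _

variable [Nonempty ι] [IsDirectedOrder ι]

theorem exists_lift_directLimit_of_free {n : ℕ}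
    (h : (Fin n → S) →ₗ[S] Module.DirectLimit A f) :
    ∃ i, ∃ g : (Fin n → S) →ₗ[S] A i, Module.DirectLimit.of S ι A f i ∘ₗ g = h := by
  choose i a ha using fun k : Fin n =>
    Module.DirectLimit.exists_of (h (Pi.single k 1))
  obtain ⟨j, hj⟩ := Finite.exists_le i
  refine ⟨j, (Pi.basisFun S (Fin n)).constr ℕ fun k => f _ _ (hj k) (a k),
    (Pi.basisFun S (Fin n)).ext fun k => ?_⟩
  rw [LinearMap.comp_apply, Module.Basis.constr_basis, Module.DirectLimit.of_f, ha,
    Pi.basisFun_apply]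

/-- `K` is a retract of some `Sⁿ`, where lifting the basis vectors to a common stage suffices. -/
theorem exists_lift_directLimit {K : Type*} [AddCommGroup K] [Module S K] [Module.Finite S K]
    [Module.Projective S K] (h : K →ₗ[S] Module.DirectLimit A f) :
    ∃ i, ∃ g : K →ₗ[S] A i, Module.DirectLimit.of S ι A f i ∘ₗ g = h := by
  obtain ⟨n, q, e, -, -, he⟩ := Module.Finite.exists_comp_eq_id_of_projective S K
  obtain ⟨i, g, hg⟩ := exists_lift_directLimit_of_free f (h ∘ₗ q)
  refine ⟨i, g ∘ₗ e, ?_⟩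
  rw [← LinearMap.comp_assoc, hg, LinearMap.comp_assoc, he, LinearMap.comp_id]

variable [DirectedSystem A (fun i j hij => f i j hij)]

theorem exists_comp_eq_zero {K : Type*} [AddCommGroup K] [Module S K] [Module.Finite S K]
    {i : ι} (h : K →ₗ[S] A i) (hh : Module.DirectLimit.of S ι A f i ∘ₗ h = 0) :
    ∃ j, ∃ hij : i ≤ j, f i j hij ∘ₗ h = 0 := by
  obtain ⟨t, ht⟩ := Module.Finite.fg_top (R := S) (M := K)
  choose j hij hj using fun k : t =>
    Module.DirectLimit.of.zero_exact (R := S) (f := f) (LinearMap.congr_fun hh k)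
  obtain ⟨l, hl⟩ := Finite.exists_le j
  obtain ⟨m, hlm, him⟩ := exists_ge_ge l i
  refine ⟨m, him, LinearMap.ext_on ht fun k hk => ?_⟩
  have h1 := DirectedSystem.map_map (f := fun i j hij => f i j hij) (hij ⟨k, hk⟩)
    ((hl ⟨k, hk⟩).trans hlm) (h k)
  rw [LinearMap.comp_apply, ← h1, hj ⟨k, hk⟩, map_zero, LinearMap.zero_apply]

instance extMap_directedSystem (n : ℕ) :
    DirectedSystem (fun i => Abelian.Ext.{u} (ModuleCat.of S M) (ModuleCat.of S (A i)) n)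
      (fun i j hij => extMap n M (f i j hij)) where
  map_self i x := by
    have : f i i le_rfl = LinearMap.id :=
      LinearMap.ext fun a => DirectedSystem.map_self (f := fun i j hij => f i j hij) a
    rw [this, extMap_id]
  map_map i j k hij hjk x := by
    rw [extMap_extMap]
    congr 2
    exact LinearMap.ext fun a =>
      DirectedSystem.map_map (f := fun i j hij => f i j hij) hij hjk a

variable {M}

/-- `F` need not be finitely generated, so a map from `F` to the limit may not lift to a stage.
Since `b ∘ a` fixes `ker p`, such a map can be replaced by one factoring through `E`, which does
lift. -/
theorem directLimitMap_bijective {F : Type u} [AddCommGroup F] [Module S F]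
    [Module.Projective S F] {p : F →ₗ[S] M} (hp : Function.Surjective p)
    [Module.Finite S (LinearMap.ker p)] [Module.Projective S (LinearMap.ker p)]
    {E : Type u} [AddCommGroup E] [Module S E] [Module.Finite S E] [Module.Projective S E]
    (a : F →ₗ[S] E) (b : E →ₗ[S] F) (hab : ∀ k ∈ LinearMap.ker p, b (a k) = k) :
    Function.Bijective (directLimitMap 1 M A f) := by
  constructor
  · rw [injective_iff_map_eq_zero]
    intro z hz
    induction z using AddCommGroup.DirectLimit.induction_on with | _ i x
    obtain ⟨h, rfl⟩ := connecting_surjective hp x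
    rw [directLimitMap_of, extMap_connecting] at hz
    obtain ⟨w, hw⟩ := exists_extends_of_connecting_eq_zero hp hz
    obtain ⟨j, v, hv⟩ := exists_lift_directLimit f (w ∘ₗ b)
    obtain ⟨k, hik, hjk⟩ := exists_ge_ge i j
    -- `h` and the lifted extension agree in the limit, so their difference `d` dies at a later
    -- stage.
    let d : LinearMap.ker p →ₗ[S] A k :=
      f i k hik ∘ₗ h - (f j k hjk ∘ₗ v ∘ₗ a) ∘ₗ (LinearMap.ker p).subtype
    have hd : Module.DirectLimit.of S ι A f k ∘ₗ d = 0 := by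
      ext x
      have h1 := LinearMap.congr_fun hw x
      have h2 := LinearMap.congr_fun hv (a x)
      simp only [LinearMap.comp_apply, Submodule.subtype_apply, hab x x.2] at h1 h2
      simp [d, Module.DirectLimit.of_f, h1, h2]
    obtain ⟨l, hkl, hl⟩ := exists_comp_eq_zero f d hd
    have h0 : extMap 1 M (f k l hkl) (extMap 1 M (f i k hik) (connecting hp h)) = 0 := by
      have h3 : connecting hp (f k l hkl ∘ₗ d) = 0 := by
        rw [hl, ← sub_self 0, connecting_sub, sub_self]
      rwa [← extMap_connecting, connecting_sub, connecting_eq_zero_of_extends, sub_zero,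
        ← extMap_connecting] at h3
    rw [← AddCommGroup.DirectLimit.of_f (hij := hik), ← AddCommGroup.DirectLimit.of_f (hij := hkl),
      h0, map_zero]
  · intro x
    obtain ⟨h, rfl⟩ := connecting_surjective hp x
    obtain ⟨i, g, rfl⟩ := exists_lift_directLimit f h
    exact ⟨AddCommGroup.DirectLimit.of _ _ i (connecting hp g), by
      rw [directLimitMap_of, extMap_connecting]⟩

end DirectLimit

end ExtComm

namespace ExtComm

/-! ### Submodules of projective modules over a hereditary ring. -/

section Hereditary

variable {S : Type*} [Ring S]

/-- A submodule of the free module `ι →₀ S` is the direct sum of left ideals of `S`, namely of the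
leading coefficient ideals with respect to a well-order on `ι`, provided that these are
projective. -/
theorem projective_submodule_finsupp (hS : ∀ I : Submodule S S, Module.Projective S I)
    (ι : Type*) (K : Submodule S (ι →₀ S)) : Module.Projective S K := by
  classical
  let _ : LinearOrder ι := WellOrderingRel.isWellOrder.linearOrder
  have hwf : WellFoundedLT ι := WellOrderingRel.isWellOrder.toIsWellFounded
  -- `T i` consists of the elements supported in indices at most `i`, and `c i` reads off the
  -- coefficient at `i`.
  let T : ι → Submodule S K := fun i =>
    { carrier := {x | ∀ j, i < j → x.1 j = 0}
      add_mem' := fun {x y} hx hy j hj => by simp [hx j hj, hy j hj]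
      zero_mem' := fun j _ => rfl
      smul_mem' := fun r x hx j hj => by simp [hx j hj] }
  let c : ∀ i, T i →ₗ[S] S := fun i => Finsupp.lapply i ∘ₗ K.subtype ∘ₗ (T i).subtype
  have hsec : ∀ i, ∃ s : LinearMap.range (c i) →ₗ[S] T i, (c i).rangeRestrict ∘ₗ s = .id :=
    fun i => (c i).rangeRestrict.exists_rightInverse_of_surjective (c i).range_rangeRestrict
  choose s hs using hsec
  have hs_diag : ∀ i a, (s i a).1.1 i = a := fun i a =>
    congrArg Subtype.val (LinearMap.congr_fun (hs i) a)
  let Φ : (Π₀ i, LinearMap.range (c i)) →ₗ[S] K :=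
    DFinsupp.lsum ℕ fun i => (T i).subtype ∘ₗ s i
  have hΦ_single : ∀ i a, Φ (DFinsupp.single i a) = (s i a).1 := fun i a => by simp [Φ]
  have hinj : Function.Injective Φ := by
    rw [injective_iff_map_eq_zero]
    intro d hd
    by_contra hne
    have hsupp : d.support.Nonempty := by
      rwa [Finset.nonempty_iff_ne_empty, Ne, DFinsupp.support_eq_empty]
    obtain ⟨i, hi, hmax⟩ := d.support.exists_max_image id hsupp
    refine DFinsupp.mem_support_iff.1 hi (Subtype.ext ?_)
    have h1 : Φ d = ∑ j ∈ d.support, (s j (d j)).1 := by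
      conv_lhs => rw [← DFinsupp.sum_single (f := d), DFinsupp.sum, map_sum]
      exact Finset.sum_congr rfl fun j _ => hΦ_single j _
    have h2 : (Φ d).1 i = d i := by
      rw [h1, Submodule.coe_sum, Finsupp.finsetSum_apply, Finset.sum_eq_single_of_mem i hi,
        hs_diag]
      intro j hj hji
      exact (s j (d j)).2 i (lt_of_le_of_ne (hmax j hj) hji)
    rw [← h2, hd]
    rfl
  have hsurj : Function.Surjective Φ := by
    -- Subtracting the section's value at the leading coefficient strictly lowers the leading index,
    -- so well-founded induction applies.
    have key : ∀ i, T i ≤ LinearMap.range Φ := by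
      intro i
      induction i using WellFoundedLT.induction with | _ i ih
      intro x hx
      let a : LinearMap.range (c i) := ⟨x.1 i, ⟨⟨x, hx⟩, rfl⟩⟩
      set y : K := x - (s i a).1 with hy
      have hyT : y ∈ LinearMap.range Φ := by
        have hy0 : ∀ j, i ≤ j → y.1 j = 0 := by
          intro j hj
          rcases hj.eq_or_lt with rfl | hj
          · simp [hy, hs_diag, a]
          · simp [hy, hx j hj, (s i a).2 j hj]
        by_cases hsupp : y.1.support.Nonempty
        · obtain ⟨j, hj, hmax⟩ := y.1.support.exists_max_image id hsupp
          refine ih j ?_ ?_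
          · by_contra hle
            exact Finsupp.mem_support_iff.1 hj (hy0 j (not_lt.1 hle))
          · intro k hk
            by_contra hne
            exact absurd (hmax k (Finsupp.mem_support_iff.2 hne)) (not_le.2 hk)
        · rw [Finset.not_nonempty_iff_eq_empty, Finsupp.support_eq_empty] at hsupp
          rw [show y = 0 from Subtype.ext hsupp]
          exact zero_mem _
      have hxy : x = y + Φ (DFinsupp.single i a) := by
        rw [hΦ_single]
        exact (sub_add_cancel x _).symm
      rw [hxy]
      exact add_mem hyT ⟨_, rfl⟩
    intro x
    by_cases hsupp : x.1.support.Nonempty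
    · obtain ⟨j, hj, hmax⟩ := x.1.support.exists_max_image id hsupp
      refine key j fun k hk => ?_
      by_contra hne
      exact absurd (hmax k (Finsupp.mem_support_iff.2 hne)) (not_le.2 hk)
    · rw [Finset.not_nonempty_iff_eq_empty, Finsupp.support_eq_empty] at hsupp
      exact ⟨0, by rw [map_zero]; exact Subtype.ext hsupp.symm⟩
  have (i : ι) : Module.Projective S (LinearMap.range (c i)) := hS _
  exact Module.Projective.of_equiv (LinearEquiv.ofBijective Φ ⟨hinj, hsurj⟩)

theorem projective_of_injective (hS : ∀ I : Submodule S S, Module.Projective S I)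
    {K P : Type*} [AddCommGroup K] [Module S K] [AddCommGroup P] [Module S P]
    [hP : Module.Projective S P] (g : K →ₗ[S] P) (hg : Function.Injective g) :
    Module.Projective S K := by
  obtain ⟨s, hs⟩ := hP.out
  have := projective_submodule_finsupp hS P (LinearMap.range (s ∘ₗ g))
  exact Module.Projective.of_equiv
    (LinearEquiv.ofInjective (s ∘ₗ g) (hs.injective.comp hg)).symm

end Hereditary

/-! ### Splitting off a projective summand. -/

section Splitting

variable {S : Type*} [Ring S]

theorem finitePresentation_of_retract {H N : Type*} [AddCommGroup H] [Module S H]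
    [AddCommGroup N] [Module S N] [Module.FinitePresentation S H] (a : N →ₗ[S] H)
    (b : H →ₗ[S] N) (hab : b ∘ₗ a = .id) : Module.FinitePresentation S N := by
  have hba : ∀ n, b (a n) = n := LinearMap.congr_fun hab
  refine Module.finitePresentation_of_surjective b (fun n => ⟨a n, hba n⟩) ?_
  have : LinearMap.ker b = LinearMap.range (LinearMap.id - a ∘ₗ b) := by
    ext x
    constructor
    · intro hx
      exact ⟨x, by simp [LinearMap.mem_ker.1 hx]⟩
    · rintro ⟨y, rfl⟩
      simp [hba]
  rw [this, LinearMap.range_eq_map]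
  exact Module.Finite.fg_top.map _

theorem exists_finset_le_supported {ι : Type*} {L : Submodule S (ι →₀ S)} (hL : L.FG) :
    ∃ s : Finset ι, L ≤ Finsupp.supported S S (s : Set ι) := by
  classical
  obtain ⟨t, rfl⟩ := hL
  refine ⟨t.biUnion Finsupp.support, Submodule.span_le.2 fun x hx => ?_⟩
  exact Finset.coe_subset.2 (Finset.subset_biUnion_of_mem Finsupp.support hx)

/-- If the identity of the kernel of a free cover `p` of `M` agrees, up to a map which extends to
the free module, with a map of finitely generated image, then `M` is the direct sum of a
finitely presented and a projective module. -/
theorem exists_isCompl_of_fg (hS : ∀ I : Submodule S S, Module.Projective S I)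
    {M ι : Type*} [AddCommGroup M] [Module S M] {p : (ι →₀ S) →ₗ[S] M}
    (hp : Function.Surjective p) (g : (ι →₀ S) →ₗ[S] LinearMap.ker p)
    {L : Submodule S (LinearMap.ker p)} (hL : L.FG) (hg : ∀ k : LinearMap.ker p, k - g k ∈ L) :
    ∃ N P : Submodule S M,
      IsCompl N P ∧ Module.FinitePresentation S N ∧ Module.Projective S P := by
  classical
  let L' : Submodule S (ι →₀ S) := L.map (LinearMap.ker p).subtype
  have hL' : L'.FG := hL.map _
  have hL'p : ∀ x ∈ L', p x = 0 := by
    rintro _ ⟨k, -, rfl⟩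
    exact k.2
  obtain ⟨s, hs⟩ := exists_finset_le_supported hL'
  -- `φ` does not change `p` and maps `ker p` into `L'`, so modulo `L'` it descends to `M`.
  let φ : (ι →₀ S) →ₗ[S] (ι →₀ S) := .id - (LinearMap.ker p).subtype ∘ₗ g
  have hφL : ∀ k, p k = 0 → φ k ∈ L' := fun k hk => ⟨_, hg ⟨k, hk⟩, rfl⟩
  have hpφ : ∀ x, p (φ x) = p x := fun x => by simp [φ]
  let e : (s →₀ S) →ₗ[S] (ι →₀ S) := Finsupp.lmapDomain S S Subtype.val
  let r : (ι →₀ S) →ₗ[S] (s →₀ S) := Finsupp.lcomapDomain Subtype.val Subtype.val_injective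
  let r' : (ι →₀ S) →ₗ[S] ((sᶜ : Set ι) →₀ S) :=
    Finsupp.lcomapDomain Subtype.val Subtype.val_injective
  have her : ∀ x, r' x = 0 → e (r x) = x := by
    intro x hx
    have hxs : ∀ i, i ∉ s → x i = 0 := fun i hi => DFunLike.congr_fun hx ⟨i, hi⟩
    refine Finsupp.mapDomain_comapDomain _ Subtype.val_injective _ fun i hi => ?_
    by_contra hne
    exact Finsupp.mem_support_iff.1 hi (hxs i fun h => hne ⟨⟨i, h⟩, rfl⟩)
  have hr' : ∀ x ∈ L', r' x = 0 := by
    intro x hx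
    ext i
    by_contra hne
    exact i.2 (hs hx (Finsupp.mem_support_iff.2 hne))
  -- `c` takes the coordinates of `φ` outside `s`, where `L'` vanishes.
  let c : M →ₗ[S] ((sᶜ : Set ι) →₀ S) :=
    (LinearMap.ker p).liftQ (r' ∘ₗ φ) (fun k hk => hr' _ (hφL k hk)) ∘ₗ
      (p.quotKerEquivOfSurjective hp).symm.toLinearMap
  have hc : ∀ x, c (p x) = r' (φ x) := by
    intro x
    have : (p.quotKerEquivOfSurjective hp).symm (p x) = Submodule.Quotient.mk x := by
      rw [LinearEquiv.symm_apply_eq]; rfl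
    rw [LinearMap.comp_apply, LinearEquiv.coe_coe, this]
    rfl
  let H := (s →₀ S) ⧸ L'.map r
  have hH : Module.FinitePresentation S H :=
    Module.finitePresentation_of_surjective (L'.map r).mkQ (Submodule.mkQ_surjective _)
      (by rw [Submodule.ker_mkQ]; exact hL'.map r)
  -- `α` takes the coordinates in `s`. On `ker c` these are all the coordinates, so `β` undoes `α`
  -- there.
  let α : M →ₗ[S] H :=
    (LinearMap.ker p).liftQ ((L'.map r).mkQ ∘ₗ r ∘ₗ φ)
      (fun k hk => (Submodule.Quotient.mk_eq_zero _).2 ⟨_, hφL k hk, rfl⟩) ∘ₗ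
      (p.quotKerEquivOfSurjective hp).symm.toLinearMap
  have hα : ∀ x, α (p x) = (L'.map r).mkQ (r (φ x)) := by
    intro x
    have : (p.quotKerEquivOfSurjective hp).symm (p x) = Submodule.Quotient.mk x := by
      rw [LinearEquiv.symm_apply_eq]; rfl
    rw [LinearMap.comp_apply, LinearEquiv.coe_coe, this]
    rfl
  let β : H →ₗ[S] M := (L'.map r).liftQ (p ∘ₗ e) (by
    rintro _ ⟨x, hx, rfl⟩
    rw [LinearMap.mem_ker, LinearMap.comp_apply, her x (hr' x hx), hL'p x hx])
  have hβα : ∀ n ∈ LinearMap.ker c, β (α n) = n := by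
    intro n hn
    obtain ⟨x, rfl⟩ := hp n
    rw [LinearMap.mem_ker, hc] at hn
    rw [hα, Submodule.mkQ_apply, Submodule.liftQ_apply, LinearMap.comp_apply, her _ hn, hpφ]
  have hproj : Module.Projective S (LinearMap.range c) :=
    projective_of_injective (K := LinearMap.range c) hS (LinearMap.range c).subtype Subtype.val_injective
  obtain ⟨t, ht⟩ :=
    c.rangeRestrict.exists_rightInverse_of_surjective c.range_rangeRestrict
  have ht' : ∀ y, c.rangeRestrict (t y) = y := LinearMap.congr_fun ht
  have htinj : Function.Injective t := Function.LeftInverse.injective ht'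
  have hcompl : IsCompl (LinearMap.ker c) (LinearMap.range t) := by
    rw [← c.ker_rangeRestrict]
    refine ⟨Submodule.disjoint_def.2 ?_, Submodule.codisjoint_iff_exists_add_eq.2 fun m => ?_⟩
    · rintro _ hx ⟨y, rfl⟩
      rw [LinearMap.mem_ker, ht'] at hx
      rw [hx, map_zero]
    · exact ⟨m - t (c.rangeRestrict m), t (c.rangeRestrict m),
        by rw [LinearMap.mem_ker, map_sub, ht', sub_self], ⟨_, rfl⟩, sub_add_cancel _ _⟩
  refine ⟨LinearMap.ker c, LinearMap.range t, hcompl, ?_,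
    .of_equiv (LinearEquiv.ofInjective t htinj)⟩
  refine finitePresentation_of_retract (α ∘ₗ (LinearMap.ker c).subtype)
    (Submodule.projectionOnto _ _ hcompl ∘ₗ β) ?_
  refine LinearMap.ext fun n => ?_
  simp only [LinearMap.comp_apply, Submodule.subtype_apply, hβα n n.2, LinearMap.id_apply,
    Submodule.projectionOnto_apply_left hcompl n]

end Splitting
end ExtComm

/-! ### The implications between the four conditions. -/

namespace ExtComm

variable {S : Type u} [Ring S] {M : Type u} [AddCommGroup M] [Module S M]

/-- If the identity of `ker p` is, in `Ext¹(M, ker p)`, the image of a class along the inclusion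
of a finitely generated submodule, then `M` is the direct sum of a finitely presented and a
projective module. -/
theorem exists_isCompl_of_connecting_id (hS : ∀ I : Submodule S S, Module.Projective S I)
    {ι : Type u} {p : (ι →₀ S) →ₗ[S] M} (hp : Function.Surjective p)
    (k : LinearMap.ker p →ₗ[S] LinearMap.ker p) {L : Submodule S (LinearMap.ker p)} (hL : L.FG)
    (hk : LinearMap.range k ≤ L)
    (h : connecting hp (A := LinearMap.ker p) .id = connecting hp k) :
    ∃ N P : Submodule S M,
      IsCompl N P ∧ Module.FinitePresentation S N ∧ Module.Projective S P := by
  rw [← sub_eq_zero, ← connecting_sub] at h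
  obtain ⟨g, hg⟩ := exists_extends_of_connecting_eq_zero hp h
  refine exists_isCompl_of_fg hS hp g hL fun x => ?_
  have hgx : g x = x - k x := LinearMap.congr_fun hg x
  have hkx : x - g x = k x := by
    rw [hgx]
    exact sub_sub_cancel x (k x)
  rw [hkx]
  exact hk ⟨x, rfl⟩

/-- `K` is the direct limit of its finitely generated submodules. -/
theorem exists_finite_extMap_eq (hM : CommutesWithDirectLimits S 1 M) {K : Type u}
    [AddCommGroup K] [Module S K]
    (x : Abelian.Ext.{u} (ModuleCat.of S M) (ModuleCat.of S K) 1) :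
    ∃ (E : Type u) (_ : AddCommGroup E) (_ : Module S E) (_ : Module.Finite S E) (j : E →ₗ[S] K)
      (y : Abelian.Ext.{u} (ModuleCat.of S M) (ModuleCat.of S E) 1), extMap 1 M j y = x := by
  classical
  let e := Module.fgSystem.equiv S K
  obtain ⟨z, hz⟩ := (hM _ _ (Module.fgSystem S K)).2 (extMap 1 M e.symm.toLinearMap x)
  induction z using AddCommGroup.DirectLimit.induction_on with | _ L y
  refine ⟨L.1, inferInstance, inferInstance, Module.Finite.iff_fg.2 L.2, L.1.subtype, y, ?_⟩
  rw [directLimitMap_of] at hz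
  have hz' := congrArg (extMap 1 M e.toLinearMap) hz
  rwa [extMap_extMap, extMap_extMap, LinearEquiv.comp_symm, extMap_id,
    Module.fgSystem.equiv_comp_of] at hz'

theorem exists_isCompl_of_commutesWithDirectLimits
    (hS : ∀ I : Submodule S S, Module.Projective S I) (hM : CommutesWithDirectLimits S 1 M) :
    ∃ N P : Submodule S M,
      IsCompl N P ∧ Module.FinitePresentation S N ∧ Module.Projective S P := by
  have hp := Finsupp.linearCombination_id_surjective S M
  set p := Finsupp.linearCombination S (id : M → M)
  obtain ⟨E, _, _, _, j, x, hx⟩ := exists_finite_extMap_eq hM (K := LinearMap.ker p)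
    (connecting hp (A := LinearMap.ker p) .id)
  obtain ⟨h, rfl⟩ := connecting_surjective hp x
  rw [extMap_connecting] at hx
  refine exists_isCompl_of_connecting_id hS hp (j ∘ₗ h) (L := LinearMap.range j) ?_
    (LinearMap.range_comp_le_range _ _) hx.symm
  rw [LinearMap.range_eq_map]
  exact Module.Finite.fg_top.map _

/-- `B` allows for the right module `R`, which is isomorphic but not equal to `Rᵐᵒᵖ`. -/
theorem exists_isCompl_of_commutesWithDirectSumsOfCopies
    (hS : ∀ I : Submodule S S, Module.Projective S I) {B : Type u} [AddCommGroup B] [Module S B]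
    (e : B ≃ₗ[S] S) (hM : CommutesWithDirectSumsOfCopies S 1 M B) :
    ∃ N P : Submodule S M,
      IsCompl N P ∧ Module.FinitePresentation S N ∧ Module.Projective S P := by
  classical
  have hp := Finsupp.linearCombination_id_surjective S M
  set p := Finsupp.linearCombination S (id : M → M)
  let K := LinearMap.ker p
  have hK : Module.Projective S K := projective_submodule_finsupp hS M K
  obtain ⟨r, hr⟩ : ∃ r : (DirectSum K fun _ => B) →ₗ[S] K, Function.Surjective r := by
    refine ⟨DirectSum.toModule S K K fun k => LinearMap.toSpanSingleton S K k ∘ₗ e.toLinearMap,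
      fun k => ⟨DirectSum.lof S K (fun _ => B) k (e.symm 1), ?_⟩⟩
    simp
  -- As `K` is projective, the identity factors as `r ∘ u` through copies of `B`; the class of `u`
  -- comes from finitely many of them.
  obtain ⟨u, hu⟩ := r.exists_rightInverse_of_surjective (LinearMap.range_eq_top.2 hr)
  obtain ⟨z, hz⟩ := (hM K).2 (connecting hp u)
  choose h hh using fun i => connecting_surjective hp (z i)
  have hz' := congrArg (extMap 1 M (B := K) r) hz
  rw [extMap_connecting, hu, ← DirectSum.sum_support_of z, map_sum, map_sum] at hz'
  simp only [directSumMap_of, ← hh, extMap_connecting] at hz'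
  rw [← connecting_sum] at hz'
  have hB : Module.Finite S B := Module.Finite.equiv e.symm
  refine exists_isCompl_of_connecting_id hS hp _
    (L := ⨆ i ∈ z.support, LinearMap.range (r ∘ₗ DirectSum.lof S K (fun _ => B) i))
    (Submodule.fg_biSup _ _ fun i _ => ?_) ?_ hz'.symm
  · rw [LinearMap.range_eq_map]
    exact Module.Finite.fg_top.map _
  · rintro _ ⟨x, rfl⟩
    rw [LinearMap.sum_apply]
    exact sum_mem fun i hi => Submodule.mem_iSup_of_mem i
      (Submodule.mem_iSup_of_mem hi ⟨h i x, rfl⟩)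

theorem commutes_of_isCompl (hS : ∀ I : Submodule S S, Module.Projective S I)
    {N P : Submodule S M} (hNP : IsCompl N P) [Module.FinitePresentation S N]
    [Module.Projective S P] : CommutesWithDirectLimits S 1 M ∧ CommutesWithDirectSums S 1 M := by
  obtain ⟨n, q, hq⟩ := Module.Finite.exists_fin' S N
  have hker : (LinearMap.ker q).FG := Module.FinitePresentation.fg_ker q hq
  let d := Submodule.prodEquivOfIsCompl N P hNP
  -- Covering `P` by itself adds nothing to the kernel, so `ker p` is a copy of `ker q` inside `Sⁿ`.
  let p : ((Fin n → S) × P) →ₗ[S] M := d.toLinearMap ∘ₗ q.prodMap .id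
  have hp : Function.Surjective p :=
    d.surjective.comp (Function.Surjective.prodMap hq Function.surjective_id)
  have hpk : LinearMap.ker p = (LinearMap.ker q).map (LinearMap.inl S (Fin n → S) P) := by
    rw [LinearMap.ker_comp_of_ker_eq_bot _ (LinearEquiv.ker d), LinearMap.ker_prodMap,
      LinearMap.ker_id, Submodule.map_inl]
  have hfin : Module.Finite S (LinearMap.ker p) := by
    rw [Module.Finite.iff_fg, hpk]
    exact hker.map _
  have hproj : Module.Projective S (LinearMap.ker p) :=
    projective_of_injective (K := LinearMap.ker p) hS (LinearMap.ker p).subtype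
      Subtype.val_injective
  constructor
  · intro ι _ _ _ _ A _ _ f _
    refine directLimitMap_bijective f hp (.fst S _ _) (.inl S _ _) fun k hk => ?_
    rw [hpk] at hk
    obtain ⟨x, -, rfl⟩ := hk
    rfl
  · intro ι _ A _ _
    exact ⟨directSumMap_injective M A 1, directSumMap_surjective A hp⟩

end ExtComm

/-- The right module `R` is the free module of rank one over `Rᵐᵒᵖ`. -/
def opLinearEquivSelf (R : Type u) [Ring R] : R ≃ₗ[Rᵐᵒᵖ] Rᵐᵒᵖ :=
  { MulOpposite.opAddEquiv with map_smul' := fun _ _ => rfl }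

theorem IsRightHereditary.projective_submodule {R : Type u} [Ring R] (hR : IsRightHereditary R)
    (I : Submodule Rᵐᵒᵖ Rᵐᵒᵖ) : Module.Projective Rᵐᵒᵖ I :=
  have := hR (I.map (opLinearEquivSelf R).symm.toLinearMap)
  .of_equiv ((opLinearEquivSelf R).symm.submoduleMap I).symm

theorem corollary2p5 (R : Type u) [Ring R] (hR : IsRightHereditary R)
    (M : Type u) [AddCommGroup M] [Module Rᵐᵒᵖ M] :
    List.TFAE
      [ExtComm.CommutesWithDirectLimits Rᵐᵒᵖ 1 M,
       ExtComm.CommutesWithDirectSums Rᵐᵒᵖ 1 M,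
       ExtComm.CommutesWithDirectSumsOfCopies Rᵐᵒᵖ 1 M R,
       ∃ N P : Submodule Rᵐᵒᵖ M,
         IsCompl N P ∧ Module.FinitePresentation Rᵐᵒᵖ N ∧ Module.Projective Rᵐᵒᵖ P] := by
  have hS := hR.projective_submodule
  tfae_have 1 → 4 := ExtComm.exists_isCompl_of_commutesWithDirectLimits hS
  tfae_have 4 → 1 := fun ⟨_, _, h, _, _⟩ => (ExtComm.commutes_of_isCompl hS h).1
  tfae_have 4 → 2 := fun ⟨_, _, h, _, _⟩ => (ExtComm.commutes_of_isCompl hS h).2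
  tfae_have 2 → 3 := fun h ι _ => h ι fun _ => R
  tfae_have 3 → 4 :=
    ExtComm.exists_isCompl_of_commutesWithDirectSumsOfCopies hS (opLinearEquivSelf R)
  tfae_finish
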